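/- **Setting.** Let $\alpha>2$ and let $X$ be a metric space in which, for constants $C$ and $m<\alpha$, every ball of radius $r$ contains at most $C(r/r')^m$ pairwise disjoint balls of radius $r'$, for all $0<r'<r$ ($X$ with path loss exponent $\alpha$ is a *fading metric*). A set $L=\{1,\dots,n\}$ of links is given, each link $v$ having a sender $s_v\in X$ and a receiver $r_v\in X$, with length $l_v=d(s_v,r_v)>0$. In the directed model $d_{vw}=d(s_v,r_w)$. For powers $P_v>0$, a set $S$ of links and a link $v$, the affectance is $$a_S(v)=\sum_{w\in S\setminus\{v\}}\frac{P_w/d_{wv}^\alpha}{P_v/l_v^\alpha}$$ (infinite if some $d_{wv}=0$), and $a_w(v)=a_{\{w\}}(v)$. A set $S$ is *SINR-feasible* if $a_S(v)<1$ for all $v\in S$. A *schedule* is a partition of $L$ into SINR-feasible sets (slots); its length is the number of slots. The *mean power assignment* is $P_v=c\,l_v^{\alpha/2}$, with a constant $c>0$. Links $v,w$ are *$\tau$-close* if $\max\{a_v(w),a_w(v)\}\ge\tau$ under mean power. $D_3(L)$ is the graph on $L$ in which distinct $v,w$ are adjacent if and only if $d_{vw}\le 3\sqrt{l_vl_w}$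 or $d_{wv}\le 3\sqrt{l_vl_w}$. *First fit* treats items one by one and puts each into the first existing bin that admits it, opening a new bin if there is none. **Algorithm 1** (input: $Q\subseteq L$). Let $l_{\min}$ be the minimum length in $Q$, let $Q_i=\{v\in Q: 2^{i-1}l_{\min}\le l_v<2^il_{\min}\}$ for $i\ge1$, let $M=\lceil 2\log_2 n\rceil+1$, and let $B_i=\bigcup_{j\ge0}Q_{i+jM}$ for $i=1,\dots,M$. For each $B_i$: 1. Refine each non-empty $K_j=Q_{i+jM}$ into slots $S_j^1,\dots,S_j^{k_j}$ as follows, with $f=2^{\alpha/2+1}$ and uniform powers: apply first fit to $K_j$, a bin $B$ admitting $v$ if $a_B(v)<1/(2f)$; then apply the same first fit within each resulting bin, in the opposite order. 2. For each $s\le\max_jk_j$, sort $\bigcup_jS_j^s$ (where $S_j^s=\emptyset$ if $s>k_j$) in non-increasing order of length and distribute it into slots by first fit, a slot $T$ admitting $v$ if it contains no link $u$ with $l_u>n^2l_v$ that is $\frac1{2n}$-close to $v$. Output all the slots obtained, for all $i$ and $s$. **Algorithm 2** (directed model, input: $L$). Colour $D_3(L)$ greedily in smallest-last order (repeatedly remove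 a vertex of minimum degree in the remaining graph; then, in the reverse order of removal, give each vertex the first colour not used by its already coloured neighbours). Apply Algorithm 1 to each colour class and output the union of the schedules obtained. **Theorem.** There is a constant $K$, depending only on $\alpha$, $C$ and $m$, such that for every such $X$, every set $L$ of $n$ links in $X$ and every $c>0$, the output of Algorithm 2 is a schedule of $L$ with respect to the mean power assignment, and, if $n\ge2$, its length is at most $K\log n$ times the length of every schedule of $L$ with respect to the mean power assignment, hence at most $K\log n$ times the minimum length of such a schedule. -/

import Mathlib

open scoped ENNReal

noncomputable section

namespace Wireless

/-! ### The model -/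

/-- A metric space in which a ball of radius `r` contains at most `C * (r / r') ^ m` pairwise
disjoint balls of a smaller radius `r'`. Together with a path loss exponent `α > m` such a space
is a fading metric. -/
def IsDoubling (X : Type*) [MetricSpace X] (C m : ℝ) : Prop :=
  ∀ (x : X) (r r' : ℝ), 0 < r' → r' < r → ∀ T : Finset X,
    (∀ t ∈ T, Metric.ball t r' ⊆ Metric.ball x r) →
    (T : Set X).PairwiseDisjoint (fun t => Metric.ball t r') →
    (T.card : ℝ) ≤ C * (r / r') ^ m

/-- `n` communication requests (links) between nodes of `X`; every link has positive length.
Nodes of different links may coincide. -/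
structure Links (X : Type*) (n : ℕ) where
  sender : Fin n → X
  receiver : Fin n → X
  sender_ne_receiver : ∀ v, sender v ≠ receiver v

namespace Links

variable {X : Type*} [MetricSpace X] {n : ℕ} (L : Links X n)

/-- The length of a link. -/
def len (v : Fin n) : ℝ := dist (L.sender v) (L.receiver v)

/-- The asymmetric distance from `v` to `w` in the directed model. -/
def asymDist (v w : Fin n) : ℝ := dist (L.sender v) (L.receiver w)

/-- The strength at which the receiver of `v` receives the sender of `w`, under the path loss
exponent `α`. It is infinite if the two nodes coincide. -/
def received (α : ℝ) (P : Fin n → ℝ) (w v : Fin n) : ℝ≥0∞ :=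
  ENNReal.ofReal (P w) / edist (L.sender w) (L.receiver v) ^ α

/-- The affectance of `v` caused by the links of `S`: the inverse of the signal to interference
ratio of `v` when the links of `S` transmit concurrently. -/
def affectance (α : ℝ) (P : Fin n → ℝ) (S : Finset (Fin n)) (v : Fin n) : ℝ≥0∞ :=
  ∑ w ∈ S.erase v, L.received α P w v / L.received α P v v

/-- SINR-feasible slots (no noise, threshold one, strict inequality). -/
def Feasible (α : ℝ) (P : Fin n → ℝ) (S : Finset (Fin n)) : Prop :=
  ∀ v ∈ S, L.affectance α P S v < 1

/-- A schedule with given powers: a splitting of the set of all links into SINR-feasible slots.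
Its length is the length of the list. -/
def IsSchedule (α : ℝ) (P : Fin n → ℝ) (σ : List (Finset (Fin n))) : Prop :=
  (∀ S ∈ σ, L.Feasible α P S) ∧ σ.Pairwise Disjoint ∧ ∀ v, ∃ S ∈ σ, v ∈ S

/-- The mean power assignment. -/
def meanPower (α c : ℝ) (v : Fin n) : ℝ := c * L.len v ^ (α / 2)

/-- The uniform power assignment. Affectances do not depend on the common value. -/
def uniformPower (_ : Fin n) : ℝ := 1

/-- Two links are `τ`-close if at least one of them affects the other one by at least `τ`, under
the mean power assignment. -/
def Close (α c : ℝ) (τ : ℝ≥0∞) (v w : Fin n) : Prop :=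
  τ ≤ max (L.affectance α (L.meanPower α c) {v} w) (L.affectance α (L.meanPower α c) {w} v)

/-- The graph `D_q(L)`: two links are adjacent if they are not `q`-independent with respect to
the mean power assignment. -/
def graphD (q : ℝ) : SimpleGraph (Fin n) where
  Adj v w := v ≠ w ∧ (L.asymDist v w ≤ q * √(L.len w * L.len v) ∨
    L.asymDist w v ≤ q * √(L.len w * L.len v))
  symm := ⟨fun v w h => ⟨h.1.symm, by rw [mul_comm (L.len v)]; exact h.2.symm⟩⟩
  loopless := ⟨fun _ h => h.1 rfl⟩

end Links

/-! ### First fit -/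

section FirstFit

variable {β : Type*}

open scoped Classical in
/-- Append `x` to the first bin that admits it; open a new bin if there is none. -/
def placeFirst (ok : List β → β → Prop) (x : β) : List (List β) → List (List β)
  | [] => [[x]]
  | B :: Bs => if ok B x then (B ++ [x]) :: Bs else B :: placeFirst ok x Bs

/-- Treat the elements of a list one after the other, placing each in the first bin that admits
it. -/
def firstFit (ok : List β → β → Prop) (xs : List β) : List (List β) :=
  xs.foldl (fun bins x => placeFirst ok x bins) []

open scoped Classical in
/-- The smallest-last order of (the first `k` steps on) a list of vertices: a vertex that has
minimum degree in the induced subgraph is put last, and the rest is ordered the same way. -/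
def smallestLast (G : SimpleGraph β) : ℕ → List β → List β
  | 0, _ => []
  | k + 1, vs =>
    match vs.argmin (fun v => (vs.filter (fun w => G.Adj v w)).length) with
    | none => []
    | some v => smallestLast G k (vs.erase v) ++ [v]

/-- Colouring with at most `δ(G) + 1` colours, `δ(G)` being the largest minimum degree of a
subgraph: each vertex in smallest-last order gets the first colour that none of its coloured
neighbours has. The result is the list of the colour classes. -/
def colourClasses (G : SimpleGraph β) (vs : List β) : List (List β) :=
  firstFit (fun B v => ∀ w ∈ B, ¬ G.Adj v w) (smallestLast G vs.length vs)

end FirstFit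

/-! ### The algorithms -/

namespace Links

variable {X : Type*} [MetricSpace X] {n : ℕ} (L : Links X n)

/-- Signal strengthening: the slot `K` is refined into slots in which every affectance is less
than `1 / f`, by first fit with the bound `1 / (2 f)` on the affectance caused by the links placed
before, in the given order, and then within each resulting bin in the opposite order. -/
def strengthen (α : ℝ) (P : Fin n → ℝ) (f : ℝ) (K : List (Fin n)) : List (List (Fin n)) :=
  let ok : List (Fin n) → Fin n → Prop := fun B v =>
    L.affectance α P B.toFinset v < ENNReal.ofReal (1 / (2 * f))
  (firstFit ok K).flatMap (fun B => firstFit ok B.reverse)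

/-- The index `i` (counted from zero) of the length class `[2 ^ i * l_min, 2 ^ (i + 1) * l_min)`
of a link, where `l_min` is the minimal length of the links of `Q`. -/
def lengthClass (Q : List (Fin n)) (v : Fin n) : ℕ :=
  ⌊Real.logb 2 (L.len v / sInf (L.len '' {w | w ∈ Q}))⌋₊

open scoped Classical in
/-- Distribution of a set `S` of links into slots: the links are treated in non-increasing order
of length, and each one goes to the first slot that contains no link which is more than `n ^ 2`
times longer and `1 / (2 n)`-close to it. -/
def distribute (α c : ℝ) (S : List (Fin n)) : List (List (Fin n)) :=
  firstFit
    (fun T v => ∀ u ∈ T, ¬ ((n : ℝ) ^ 2 * L.len v < L.len u ∧ L.Close α c (1 / (2 * n)) u v))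
    (S.insertionSort (fun v w => L.len w ≤ L.len v))

open scoped Classical in
/-- The algorithm for an independent set `Q` of links. The length classes of `Q` are grouped into
`M` well-separated families `B`. In each of them, every class is refined by signal strengthening
under uniform powers with `f = 2 ^ (α / 2 + 1)`, and for each `s` the union of the `s`-th slots of
all the classes is distributed into slots. -/
def scheduleIndependent (α c : ℝ) (Q : List (Fin n)) : List (List (Fin n)) :=
  let M := Nat.clog 2 (n ^ 2) + 1
  (List.range M).flatMap fun i =>
    let B := Q.filter (fun v => L.lengthClass Q v % M = i)
    let Ks := (B.map (L.lengthClass Q)).dedup.map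
      (fun k => L.strengthen α uniformPower (2 ^ (α / 2 + 1))
        (B.filter (fun v => L.lengthClass Q v = k)))
    (List.range ((Ks.map List.length).foldr max 0)).flatMap fun s =>
      L.distribute α c (Ks.flatMap (fun slots => slots.getD s []))

/-- The scheduling algorithm for arbitrary sets of links in the directed model: colour `D_3(L)`,
schedule each colour class separately, and output the union of the schedules. -/
def schedule (α c : ℝ) : List (Finset (Fin n)) :=
  ((colourClasses (L.graphD 3) (List.finRange n)).flatMap
    (L.scheduleIndependent α c)).map List.toFinset

end Links

end Wireless

end

/-! Feasibility holds for Algorithm 1 on any input, by splitting the affectance of a link into two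
halves. Links of its own length class contribute less than 1/2: strengthening keeps their
uniform-power affectance below 2^-(α/2+1), and passing to mean power costs at most a factor 2^(α/2).
The other links of the slot differ from it in length by a factor above n² and are not 1/(2n)-close
to it, so together they contribute at most 1/2 (`feasible_of_mem_distribute`).

The length is bounded by a product: colours, families, refinement indices, final slots. Colours: the
shortest link of any set has boundedly many neighbours in each slot of a schedule τ, because links
of one slot gathered around a shorter link would affect one of their own too much; so the degeneracy
of `graphD 3` is O(|τ|) (`IsSchedule.exists_length_filter_adj_le`). Families: M = O(log n), the only
source of the logarithm. In an independent colour class the last two factors are constant. Senders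
of one length class are separated, so packing bounds their affectances and first fit opens few bins
(`affectance_uniform_le`, `length_strengthen_le`). At most one much longer link is close to a given
link, so two final slots suffice (`eq_of_close_of_not_adj`). -/

namespace Wireless

/-! ### First fit, regrouping of lists, and smallest-last colouring. -/

section Lists

variable {β γ : Type*}

theorem flatten_placeFirst_perm (ok : List β → β → Prop) (x : β) (bins : List (List β)) :
    (placeFirst ok x bins).flatten.Perm (bins.flatten ++ [x]) := by
  induction bins with
  | nil => simp [placeFirst]
  | cons B Bs ih =>
    rw [placeFirst]
    split_ifs
    · simp only [List.flatten_cons, List.append_assoc]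
      exact List.perm_append_comm.append_left B
    · simp only [List.flatten_cons, List.append_assoc]
      exact ih.append_left B

theorem mem_placeFirst {ok : List β → β → Prop} {x : β} {bins : List (List β)} {B : List β}
    (h : B ∈ placeFirst ok x bins) :
    B ∈ bins ∨ B = [x] ∨ ∃ A ∈ bins, ok A x ∧ B = A ++ [x] := by
  induction bins with
  | nil => simp [placeFirst] at h; simp [h]
  | cons A As ih =>
    rw [placeFirst] at h
    split_ifs at h with hA
    · rcases List.mem_cons.1 h with rfl | h
      · exact .inr (.inr ⟨A, by simp, hA, rfl⟩)
      · exact .inl (by simp [h])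
    · rcases List.mem_cons.1 h with rfl | h
      · exact .inl (by simp)
      · rcases ih h with h | h | ⟨A', hA', h⟩
        · exact .inl (by simp [h])
        · exact .inr (.inl h)
        · exact .inr (.inr ⟨A', by simp [hA'], h⟩)

theorem length_placeFirst (ok : List β → β → Prop) (x : β) (bins : List (List β)) :
    (placeFirst ok x bins).length = bins.length ∨
      (placeFirst ok x bins).length = bins.length + 1 ∧ ∀ B ∈ bins, ¬ ok B x := by
  induction bins with
  | nil => simp [placeFirst]
  | cons A As ih =>
    rw [placeFirst]
    split_ifs with hA
    · simp
    · rcases ih with h | ⟨h, h'⟩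
      · exact .inl (by simp [h])
      · exact .inr ⟨by simp [h], by simpa [hA] using h'⟩

theorem firstFit_concat (ok : List β → β → Prop) (xs : List β) (x : β) :
    firstFit ok (xs ++ [x]) = placeFirst ok x (firstFit ok xs) := by
  simp [firstFit]

theorem flatten_firstFit_perm (ok : List β → β → Prop) (xs : List β) :
    (firstFit ok xs).flatten.Perm xs := by
  induction xs using List.reverseRecOn with
  | nil => simp [firstFit]
  | append_singleton xs x ih =>
    rw [firstFit_concat]
    exact (flatten_placeFirst_perm ok x _).trans (ih.append_right [x])

theorem mem_of_mem_firstFit {ok : List β → β → Prop} {xs B : List β}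
    (h : B ∈ firstFit ok xs) {v : β} (hv : v ∈ B) : v ∈ xs :=
  (flatten_firstFit_perm ok xs).mem_iff.1 (List.mem_flatten.2 ⟨B, h, hv⟩)

/-- Bins keep the order in which the elements are treated, and every element of a bin was
admitted by the elements of the bin that precede it. -/
theorem sublist_and_ok_of_mem_firstFit {ok : List β → β → Prop} (hnil : ∀ x, ok [] x)
    {xs B : List β} (h : B ∈ firstFit ok xs) :
    B.Sublist xs ∧ ∀ l x, l ++ [x] <+: B → ok l x := by
  induction xs using List.reverseRecOn generalizing B with
  | nil => simp [firstFit] at h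
  | append_singleton xs y ih =>
    rw [firstFit_concat] at h
    rcases mem_placeFirst h with h | rfl | ⟨A, hA, hok, rfl⟩
    · exact ⟨(ih h).1.trans (List.sublist_append_left _ _), (ih h).2⟩
    · refine ⟨List.sublist_append_right _ _, fun l x hl => ?_⟩
      have : l = [] := by
        have := hl.length_le
        simp at this
        exact this
      exact this ▸ hnil x
    · refine ⟨(ih hA).1.append (List.Sublist.refl _), fun l x hl => ?_⟩
      rcases List.prefix_concat_iff.1 hl with hl | hl
      · obtain ⟨rfl, hx⟩ := List.append_inj' hl rfl
        obtain rfl : x = y := by simpa using hx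
        exact hok
      · exact (ih hA).2 l x hl

/-- First fit uses at most `N + 1` bins if no element can be rejected by more than `N` bins. -/
theorem length_firstFit_le {ok : List β → β → Prop} {xs : List β} {N : ℕ}
    (h : ∀ l x, l ++ [x] <+: xs → ∀ bins : List (List β), bins.flatten.Perm l →
      (∀ B ∈ bins, ¬ ok B x) → bins.length ≤ N) :
    (firstFit ok xs).length ≤ N + 1 := by
  induction xs using List.reverseRecOn with
  | nil => simp [firstFit]
  | append_singleton xs y ih =>
    have ih := ih fun l x hl => h l x (hl.trans (List.prefix_append _ _))
    rw [firstFit_concat]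
    rcases length_placeFirst ok y (firstFit ok xs) with h' | ⟨h', hrej⟩
    · omega
    · have := h xs y (List.prefix_refl _) _ (flatten_firstFit_perm ok xs) hrej
      omega

/-- Pigeonhole for first fit: each rejecting bin holds its own witness, so few possible witnesses
mean few rejections. It serves both the colouring and `distribute`. -/
theorem length_le_countP_flatten (p : β → Bool) (bins : List (List β))
    (h : ∀ B ∈ bins, ∃ u ∈ B, p u) : bins.length ≤ bins.flatten.countP p := by
  induction bins with
  | nil => simp
  | cons B Bs ih =>
    have h1 : 0 < B.countP p := List.countP_pos_iff.2 (h B (by simp))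
    have h2 := ih fun A hA => h A (by simp [hA])
    simp only [List.length_cons, List.flatten_cons, List.countP_append]
    omega

theorem pairwise_of_forall_prefix {r : β → β → Prop} {xs : List β}
    (h : ∀ l x, l ++ [x] <+: xs → ∀ u ∈ l, r u x) : xs.Pairwise r := by
  induction xs using List.reverseRecOn with
  | nil => simp
  | append_singleton xs y ih =>
    refine List.pairwise_append.2
      ⟨ih fun l x hl => h l x (hl.trans (List.prefix_append _ _)), by simp, ?_⟩
    intro a ha b hb
    obtain rfl : b = y := by simpa using hb
    exact h xs b (List.prefix_refl _) a ha

theorem length_flatMap_le (l : List β) (f : β → List γ) {N : ℕ}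
    (h : ∀ a ∈ l, (f a).length ≤ N) : (l.flatMap f).length ≤ l.length * N := by
  induction l with
  | nil => simp
  | cons a l ih =>
    have h1 := h a (by simp)
    have h2 := ih fun b hb => h b (by simp [hb])
    simp only [List.flatMap_cons, List.length_append, List.length_cons]
    linarith

theorem flatten_flatMap (l : List β) (f : β → List (List γ)) :
    (l.flatMap f).flatten = l.flatMap fun a => (f a).flatten := by
  induction l with
  | nil => simp
  | cons a l ih => simp [ih]

theorem flatMap_perm_flatMap (l : List β) {f g : β → List γ} (h : ∀ a ∈ l, (f a).Perm (g a)) :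
    (l.flatMap f).Perm (l.flatMap g) := by
  induction l with
  | nil => simp
  | cons a l ih =>
    simp only [List.flatMap_cons]
    exact (h a (by simp)).append (ih fun b hb => h b (by simp [hb]))

theorem flatMap_ite_singleton [DecidableEq γ] {ks : List γ} (hks : ks.Nodup) {a : γ}
    (ha : a ∈ ks) (x : β) : (ks.flatMap fun k => if a = k then [x] else []) = [x] := by
  induction ks with
  | nil => simp at ha
  | cons k ks ih =>
    rw [List.nodup_cons] at hks
    rcases List.mem_cons.1 ha with rfl | ha'
    · have : (ks.flatMap fun k => if a = k then [x] else []) = [] := by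
        rw [List.flatMap_eq_nil_iff]
        intro k hk
        rw [if_neg]
        rintro rfl
        exact hks.1 hk
      simp [this]
    · have : a ≠ k := fun h => hks.1 (h ▸ ha')
      simp [this, ih hks.2 ha']

theorem flatMap_filter_perm [DecidableEq γ] (g : β → γ) {ks : List γ} (hks : ks.Nodup)
    (xs : List β) (h : ∀ x ∈ xs, g x ∈ ks) :
    (ks.flatMap fun k => xs.filter fun x => g x = k).Perm xs := by
  induction xs with
  | nil => simp
  | cons x xs ih =>
    have ih := ih fun y hy => h y (by simp [hy])
    have h1 : (fun k => (x :: xs).filter fun y => g y = k) =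
        fun k => (if g x = k then [x] else []) ++ xs.filter fun y => g y = k := by
      funext k
      by_cases hk : g x = k <;> simp [hk]
    rw [h1]
    refine (List.flatMap_append_perm ks _ _).symm.trans ?_
    rw [flatMap_ite_singleton hks (h x (by simp))]
    exact ih.append_left [x]

theorem flatMap_getD_eq_flatten (l : List (List β)) {N : ℕ} (h : l.length ≤ N) :
    (List.range N).flatMap (fun s => l.getD s []) = l.flatten := by
  induction l generalizing N with
  | nil => simp
  | cons a l ih =>
    obtain ⟨N, rfl⟩ : ∃ k, N = k + 1 := ⟨N - 1, by simp at h; omega⟩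
    rw [List.range_succ_eq_map]
    simp only [List.flatMap_cons, List.flatMap_map, List.flatten_cons]
    simpa using ih (N := N) (by simpa using h)

/-- Transposition: collecting slots by index `s` across all classes loses nothing compared with
collecting them class by class. Missing slots read as `[]`. -/
theorem flatMap_flatMap_getD_perm (Ks : List (List (List β))) {N : ℕ}
    (h : ∀ l ∈ Ks, l.length ≤ N) :
    ((List.range N).flatMap fun s => Ks.flatMap fun l => l.getD s []).Perm
      (Ks.flatMap List.flatten) := by
  induction Ks with
  | nil => simp
  | cons l Ks ih =>
    simp only [List.flatMap_cons]
    refine (List.flatMap_append_perm _ _ _).symm.trans ?_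
    rw [flatMap_getD_eq_flatten l (h l (by simp))]
    exact (ih fun l' hl' => h l' (by simp [hl'])).append_left _

theorem length_le_foldr_max (Ks : List (List β)) :
    ∀ l ∈ Ks, l.length ≤ (Ks.map List.length).foldr max 0 := by
  induction Ks with
  | nil => simp
  | cons a Ks ih =>
    intro l hl
    rcases List.mem_cons.1 hl with rfl | hl
    · simp
    · simpa using .inr (ih l hl)

theorem foldr_max_le (Ks : List (List β)) {N : ℕ} (h : ∀ l ∈ Ks, l.length ≤ N) :
    (Ks.map List.length).foldr max 0 ≤ N := by
  induction Ks with
  | nil => simp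
  | cons a Ks ih =>
    simp only [List.map_cons, List.foldr_cons, max_le_iff]
    exact ⟨h a (by simp), ih fun l hl => h l (by simp [hl])⟩

theorem length_le_mul_of_le_sum {l : List β} {g : β → ℝ≥0∞} {a : ℝ≥0∞}
    (h : ∀ x ∈ l, a ≤ g x) : l.length * a ≤ (l.map g).sum := by
  induction l with
  | nil => simp
  | cons x l ih =>
    have := add_le_add (h x (by simp)) (ih fun y hy => h y (by simp [hy]))
    simp only [List.length_cons, Nat.cast_add, Nat.cast_one, add_mul, one_mul, List.map_cons,
      List.sum_cons]
    rwa [add_comm]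

open scoped Classical in
theorem smallestLast_perm (G : SimpleGraph β) (k : ℕ) (vs : List β) (h : vs.length = k) :
    (smallestLast G k vs).Perm vs := by
  induction k generalizing vs with
  | zero => simp [smallestLast, List.length_eq_zero_iff.1 h]
  | succ k ih =>
    rw [smallestLast]
    split
    · next h' =>
      rw [List.argmin_eq_none] at h'
      simp [h']
    · next v hv =>
      have hv := List.argmin_mem hv
      have := ih (vs.erase v) (by rw [List.length_erase_of_mem hv]; omega)
      exact (this.append_right [v]).trans
        ((List.perm_append_singleton v _).trans (List.perm_cons_erase hv).symm)

open scoped Classical in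
/-- In smallest-last order a vertex has no more neighbours before it than the degeneracy. -/
theorem length_filter_adj_le_of_prefix_smallestLast (G : SimpleGraph β) {D : ℕ} (k : ℕ)
    (vs : List β) (hk : vs.length = k)
    (h : ∀ us : List β, us.Sublist vs → us ≠ [] →
      ∃ v ∈ us, (us.filter fun w => G.Adj v w).length ≤ D)
    {l : List β} {x : β} (hl : l ++ [x] <+: smallestLast G k vs) :
    (l.filter fun w => G.Adj x w).length ≤ D := by
  induction k generalizing vs l x with
  | zero => simp [smallestLast] at hl
  | succ k ih =>
    rw [smallestLast] at hl
    split at hl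
    · simp at hl
    · next v hv =>
      have hmem := List.argmin_mem hv
      have hlen : (vs.erase v).length = k := by rw [List.length_erase_of_mem hmem]; omega
      rcases List.prefix_concat_iff.1 hl with hl | hl
      · obtain ⟨rfl, hx⟩ := List.append_inj' hl rfl
        obtain rfl : x = v := by simpa using hx
        -- The vertex put last minimises the degree in `vs`, so the witness `u` of small degree
        -- bounds its degree as well.
        obtain ⟨u, hu, hD⟩ := h vs (List.Sublist.refl _) (List.ne_nil_of_mem hmem)
        have hmin := List.le_of_mem_argmin hu hv
        have hperm := smallestLast_perm G k _ hlen
        calc _ = ((vs.erase x).filter fun w => G.Adj x w).length :=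
              (hperm.filter _).length_eq
          _ ≤ (vs.filter fun w => G.Adj x w).length :=
              (List.erase_sublist.filter _).length_le
          _ ≤ D := hmin.trans hD
      · exact ih _ hlen (fun us hus => h us (hus.trans List.erase_sublist)) hl

open scoped Classical in
theorem length_colourClasses_le (G : SimpleGraph β) {D : ℕ} (vs : List β)
    (h : ∀ us : List β, us.Sublist vs → us ≠ [] →
      ∃ v ∈ us, (us.filter fun w => G.Adj v w).length ≤ D) :
    (colourClasses G vs).length ≤ D + 1 := by
  refine length_firstFit_le fun l x hl bins hbins hrej => ?_
  have h1 := length_filter_adj_le_of_prefix_smallestLast G _ vs rfl h hl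
  rw [← List.countP_eq_length_filter, ← hbins.countP_eq] at h1
  refine (length_le_countP_flatten _ bins fun B hB => ?_).trans h1
  simpa using hrej B hB

theorem flatten_colourClasses_perm (G : SimpleGraph β) (vs : List β) :
    (colourClasses G vs).flatten.Perm vs :=
  (flatten_firstFit_perm _ _).trans (smallestLast_perm G _ vs rfl)

theorem not_adj_of_mem_colourClasses {G : SimpleGraph β} {vs B : List β}
    (h : B ∈ colourClasses G vs) {v w : β} (hv : v ∈ B) (hw : w ∈ B) : ¬ G.Adj v w := by
  have h1 : B.Pairwise fun w v => ¬ G.Adj w v :=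
    pairwise_of_forall_prefix fun l x hl u hu hadj =>
      (sublist_and_ok_of_mem_firstFit (by simp) h).2 l x hl u hu hadj.symm
  by_cases hvw : v = w
  · exact hvw ▸ G.loopless.irrefl v
  · have : Std.Symm fun w v => ¬ G.Adj w v := ⟨fun _ _ h h' => h h'.symm⟩
    exact h1.forall hv hw hvw

end Lists

/-! ### Packing in fading metrics. -/

section Packing

variable {X ι : Type*} [MetricSpace X] {C m : ℝ}

theorem two_pow_floor_logb_le {t : ℝ} (ht : 1 ≤ t) : (2 : ℝ) ^ ⌊Real.logb 2 t⌋₊ ≤ t := by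
  rw [← Real.rpow_natCast, ← Real.le_logb_iff_rpow_le (by norm_num) (by linarith)]
  exact Nat.floor_le (Real.logb_nonneg (by norm_num) ht)

theorem lt_two_pow_floor_logb {t : ℝ} (ht : 0 < t) : t < (2 : ℝ) ^ (⌊Real.logb 2 t⌋₊ + 1) := by
  rw [← Real.rpow_natCast, ← Real.logb_lt_iff_lt_rpow (by norm_num) ht]
  exact_mod_cast Nat.lt_floor_add_one _

/-- Balls of radius l/2 around the points are disjoint and lie in the ball of radius R + l/2.
Replacing `C` by `|C|` and `m` by `max m 0` makes the bound nonnegative and monotone in the ratio.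
-/
theorem IsDoubling.card_le_of_separated (hX : IsDoubling X C m) {F : Finset ι} {p : ι → X}
    {l R : ℝ} (hl : 0 < l) (hR : 0 < R)
    (hsep : ∀ a ∈ F, ∀ b ∈ F, a ≠ b → l ≤ dist (p a) (p b)) {x : X}
    (hin : ∀ a ∈ F, dist (p a) x ≤ R) :
    (F.card : ℝ) ≤ |C| * ((R + l / 2) / (l / 2)) ^ max m 0 := by
  classical
  have hinj : Set.InjOn p F := fun a ha b hb hab => by
    by_contra hne
    have := hsep a ha b hb hne
    rw [hab, dist_self] at this
    linarith
  have h := hX x (R + l / 2) (l / 2) (by positivity) (by linarith) (F.image p) ?_ ?_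
  · rw [Finset.card_image_of_injOn hinj] at h
    have h1 : 1 ≤ (R + l / 2) / (l / 2) := by
      rw [one_le_div (by positivity)]
      linarith
    refine h.trans ?_
    gcongr
    · exact le_abs_self C
    · exact le_max_left _ _
  · intro t ht
    obtain ⟨a, ha, rfl⟩ := Finset.mem_image.1 ht
    exact Metric.ball_subset_ball' (by linarith [hin a ha])
  · intro s hs t ht hst
    obtain ⟨a, ha, rfl⟩ := Finset.mem_image.1 (Finset.mem_coe.1 hs)
    obtain ⟨b, hb, rfl⟩ := Finset.mem_image.1 (Finset.mem_coe.1 ht)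
    refine Metric.ball_disjoint_ball ?_
    have := hsep a ha b hb fun h => hst (h ▸ rfl)
    linarith

/-- A bound for the total interference of unit-separated unit-power senders. -/
noncomputable def packingBound (α C m : ℝ) : ℝ :=
  |C| * 2 ^ (3 * max m 0) * (1 - 2 ^ (max m 0 - α))⁻¹

theorem packingBound_nonneg {α : ℝ} (hα : 0 < α) (hm : m < α) : 0 ≤ packingBound α C m := by
  have : (2 : ℝ) ^ (max m 0 - α) < 1 :=
    Real.rpow_lt_one_of_one_lt_of_neg (by norm_num) (by simp [hα, hm])
  have : 0 < 1 - (2 : ℝ) ^ (max m 0 - α) := by linarith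
  unfold packingBound
  positivity

/-- In a fading metric, separated senders that are not too close to a point `x` cause bounded
interference at `x`. -/
theorem IsDoubling.sum_rpow_le (hX : IsDoubling X C m) {α : ℝ} (hα : 0 < α) (hm : m < α)
    {F : Finset ι} {p : ι → X} {l : ℝ} (hl : 0 < l)
    (hsep : ∀ a ∈ F, ∀ b ∈ F, a ≠ b → l ≤ dist (p a) (p b)) {x : X}
    (hfar : ∀ a ∈ F, l ≤ dist (p a) x) :
    ∑ a ∈ F, (l / dist (p a) x) ^ α ≤ packingBound α C m := by
  classical
  set M := max m 0 with hM
  set q : ℝ := 2 ^ (M - α) with hq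
  have hq0 : 0 ≤ q := by positivity
  have hq1 : q < 1 := Real.rpow_lt_one_of_one_lt_of_neg (by norm_num) (by simp [M, hα, hm])
  have hM0 : 0 ≤ M := le_max_right _ _
  -- Dyadic shells around `x`: shell k holds at most |C|(8·2^k)^M senders, each contributing at most
  -- 2^(-kα). Since M < α, the shells sum to a geometric series of ratio q.
  let κ : ι → ℕ := fun a => ⌊Real.logb 2 (dist (p a) x / l)⌋₊
  have hlow : ∀ a ∈ F, (2 : ℝ) ^ κ a * l ≤ dist (p a) x := fun a ha =>
    (le_div_iff₀ hl).1 (two_pow_floor_logb_le ((one_le_div hl).2 (hfar a ha)))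
  have hupp : ∀ a ∈ F, dist (p a) x ≤ (2 : ℝ) ^ (κ a + 1) * l := fun a ha =>
    ((div_lt_iff₀ hl).1
      (lt_two_pow_floor_logb (div_pos (hl.trans_le (hfar a ha)) hl))).le
  have hterm : ∀ k, ∑ a ∈ F with κ a = k, (l / dist (p a) x) ^ α ≤
      |C| * 2 ^ (3 * M) * q ^ k := by
    intro k
    have h1 : ∀ a ∈ F.filter (κ · = k), (l / dist (p a) x) ^ α ≤ ((2 : ℝ) ^ k)⁻¹ ^ α := by
      intro a ha
      obtain ⟨haF, rfl⟩ := Finset.mem_filter.1 ha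
      have hd := hl.trans_le (hfar a haF)
      refine Real.rpow_le_rpow (by positivity) ?_ hα.le
      rw [div_le_iff₀ hd, inv_mul_eq_div, le_div_iff₀ (by positivity), mul_comm]
      exact hlow a haF
    have h2 := hX.card_le_of_separated (F := F.filter (κ · = k)) (p := p) (x := x)
      (R := 2 ^ (k + 1) * l) hl (by positivity)
      (fun a ha b hb => hsep a (Finset.mem_filter.1 ha).1 b (Finset.mem_filter.1 hb).1)
      (fun a ha => by
        obtain ⟨haF, rfl⟩ := Finset.mem_filter.1 ha
        exact hupp a haF)
    have h3 : ((2 : ℝ) ^ (k + 1) * l + l / 2) / (l / 2) ≤ 2 ^ 3 * 2 ^ k := by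
      have : (1 : ℝ) ≤ 2 ^ k := one_le_pow₀ (by norm_num)
      rw [div_le_iff₀ (by positivity), pow_succ]
      nlinarith
    have h4 : (((F.filter (κ · = k)).card : ℝ)) ≤ |C| * (2 ^ 3 * 2 ^ k) ^ M :=
      h2.trans (by gcongr)
    calc _ ≤ (F.filter (κ · = k)).card • ((2 : ℝ) ^ k)⁻¹ ^ α :=
          Finset.sum_le_card_nsmul _ _ _ h1
      _ ≤ |C| * (2 ^ 3 * 2 ^ k) ^ M * ((2 : ℝ) ^ k)⁻¹ ^ α := by
          rw [nsmul_eq_mul]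
          gcongr
      _ = |C| * 2 ^ (3 * M) * q ^ k := by
          rw [Real.mul_rpow (by positivity) (by positivity), Real.inv_rpow (by positivity),
            Real.rpow_mul (by norm_num : (0 : ℝ) ≤ 2)]
          have : (((2 : ℝ) ^ k) ^ M) * (((2 : ℝ) ^ k) ^ α)⁻¹ = q ^ k := by
            rw [hq, ← Real.rpow_natCast, ← Real.rpow_natCast, ← Real.rpow_mul (by norm_num),
              ← Real.rpow_mul (by norm_num), ← Real.rpow_mul (by norm_num),
              ← Real.rpow_neg (by norm_num), ← Real.rpow_add (by norm_num)]
            congr 1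
            ring
          rw [← this]
          norm_num
          ring
  rw [← Finset.sum_fiberwise_of_maps_to (t := F.image κ)
    fun a ha => Finset.mem_image_of_mem κ ha]
  calc _ ≤ ∑ k ∈ F.image κ, |C| * 2 ^ (3 * M) * q ^ k := Finset.sum_le_sum fun k _ => hterm k
    _ = |C| * 2 ^ (3 * M) * ∑ k ∈ F.image κ, q ^ k := by rw [Finset.mul_sum]
    _ ≤ |C| * 2 ^ (3 * M) * (1 - q)⁻¹ := by
        gcongr
        rw [← tsum_geometric_of_lt_one hq0 hq1]
        exact (summable_geometric_of_lt_one hq0 hq1).sum_le_tsum _ fun k _ => by positivity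

end Packing

/-! ### Affectance between two links as a power of a distance ratio. -/

namespace Links

variable {X : Type*} [MetricSpace X] {n : ℕ} (L : Links X n) {α c : ℝ}

theorem len_pos (v : Fin n) : 0 < L.len v := dist_pos.2 (L.sender_ne_receiver v)

/-- The affectance of `v` caused by `w` alone, when `w ≠ v`. -/
noncomputable def gain (α : ℝ) (P : Fin n → ℝ) (w v : Fin n) : ℝ≥0∞ :=
  L.received α P w v / L.received α P v v

theorem affectance_eq_sum_gain (P : Fin n → ℝ) (S : Finset (Fin n)) (v : Fin n) :
    L.affectance α P S v = ∑ w ∈ S.erase v, L.gain α P w v := rfl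

theorem affectance_singleton (P : Fin n → ℝ) {v w : Fin n} (h : w ≠ v) :
    L.affectance α P {w} v = L.gain α P w v := by
  rw [affectance_eq_sum_gain, Finset.erase_eq_of_notMem (by simpa using h.symm),
    Finset.sum_singleton]

theorem received_of_dist_pos (P : Fin n → ℝ) {v w : Fin n} (h : 0 < L.asymDist w v) :
    L.received α P w v = ENNReal.ofReal (P w / L.asymDist w v ^ α) := by
  change 0 < dist (L.sender w) (L.receiver v) at h
  rw [received, edist_dist, ENNReal.ofReal_rpow_of_pos h,
    ← ENNReal.ofReal_div_of_pos (Real.rpow_pos_of_pos h α)]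
  rfl

theorem gain_of_dist_pos {P : Fin n → ℝ} (hP : ∀ v, 0 < P v) {v w : Fin n}
    (h : 0 < L.asymDist w v) :
    L.gain α P w v = ENNReal.ofReal (P w / P v * (L.len v / L.asymDist w v) ^ α) := by
  have hv : 0 < L.asymDist v v := L.len_pos v
  have := hP v
  rw [gain, L.received_of_dist_pos P h, L.received_of_dist_pos P hv,
    ← ENNReal.ofReal_div_of_pos (by positivity)]
  congr 1
  rw [Real.div_rpow (L.len_pos v).le h.le]
  have h1 : (0 : ℝ) < L.len v ^ α := Real.rpow_pos_of_pos (L.len_pos v) α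
  have h2 : (0 : ℝ) < L.asymDist w v ^ α := Real.rpow_pos_of_pos h α
  change P w / _ / (P v / L.len v ^ α) = _
  field_simp

theorem gain_of_dist_eq_zero (hα : 0 < α) {P : Fin n → ℝ} (hP : ∀ v, 0 < P v) {v w : Fin n}
    (h : L.asymDist w v = 0) : L.gain α P w v = ⊤ := by
  have hv : 0 < L.asymDist v v := L.len_pos v
  rw [gain, L.received_of_dist_pos P hv]
  have : L.received α P w v = ⊤ := by
    rw [received, edist_dist, show dist (L.sender w) (L.receiver v) = 0 from h,
      ENNReal.ofReal_zero, ENNReal.zero_rpow_of_pos hα]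
    exact ENNReal.div_zero (by simpa using hP w)
  rw [this, ENNReal.top_div_of_ne_top ENNReal.ofReal_ne_top]

theorem meanPower_pos (hc : 0 < c) (v : Fin n) : 0 < L.meanPower α c v :=
  mul_pos hc (Real.rpow_pos_of_pos (L.len_pos v) _)

theorem gain_uniform_of_dist_pos {v w : Fin n} (h : 0 < L.asymDist w v) :
    L.gain α uniformPower w v = ENNReal.ofReal ((L.len v / L.asymDist w v) ^ α) := by
  rw [L.gain_of_dist_pos (P := uniformPower) (fun _ => one_pos) h]
  simp [uniformPower]

/-- Under mean power the two lengths enter only through their geometric mean, so non-independence in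
`graphD q` amounts to a lower bound q^-α on one of the two gains. -/
theorem gain_meanPower_of_dist_pos (hc : 0 < c) {v w : Fin n} (h : 0 < L.asymDist w v) :
    L.gain α (L.meanPower α c) w v =
      ENNReal.ofReal ((√(L.len w * L.len v) / L.asymDist w v) ^ α) := by
  rw [L.gain_of_dist_pos (L.meanPower_pos hc) h]
  congr 1
  have hv := L.len_pos v
  have hw := L.len_pos w
  rw [Real.div_rpow hv.le h.le, Real.div_rpow (Real.sqrt_nonneg _) h.le, Real.sqrt_eq_rpow,
    ← Real.rpow_mul (by positivity), Real.mul_rpow hw.le hv.le, meanPower, meanPower]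
  have h1 : L.len v ^ α = L.len v ^ (α / 2) * L.len v ^ (α / 2) := by
    rw [← Real.rpow_add hv, add_halves]
  have h2 : (0 : ℝ) < L.len v ^ (α / 2) := Real.rpow_pos_of_pos hv _
  rw [h1, show 1 / 2 * α = α / 2 by ring]
  field_simp

theorem le_gain_of_dist_le (hα : 0 < α) (hc : 0 < c) {v w : Fin n} {q : ℝ} (hq : 0 < q)
    (h : L.asymDist w v ≤ q * √(L.len w * L.len v)) :
    ENNReal.ofReal (q⁻¹ ^ α) ≤ L.gain α (L.meanPower α c) w v := by
  have h0 : 0 ≤ L.asymDist w v := dist_nonneg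
  rcases h0.eq_or_lt with h0 | h0
  · rw [L.gain_of_dist_eq_zero hα (L.meanPower_pos hc) h0.symm]
    exact le_top
  · rw [L.gain_meanPower_of_dist_pos hc h0]
    refine ENNReal.ofReal_le_ofReal (Real.rpow_le_rpow (by positivity) ?_ hα.le)
    rw [le_div_iff₀ h0, inv_mul_eq_div, div_le_iff₀ hq, mul_comm]
    exact h

theorem dist_le_of_le_gain (hα : 2 < α) (hc : 0 < c) {v w : Fin n}
    (h : 1 / (2 * n) ≤ L.gain α (L.meanPower α c) w v) :
    L.asymDist w v ≤ √(2 * n) * √(L.len w * L.len v) := by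
  by_contra! hlt
  have hn : (1 : ℝ) ≤ n := by exact_mod_cast v.pos
  have h0 : 0 < L.asymDist w v := lt_of_le_of_lt (by positivity) hlt
  have hs : 0 < √(L.len w * L.len v) :=
    Real.sqrt_pos.2 (mul_pos (L.len_pos w) (L.len_pos v))
  rw [L.gain_meanPower_of_dist_pos hc h0,
    show (1 / (2 * n) : ℝ≥0∞) = ENNReal.ofReal (1 / (2 * n)) by
      rw [ENNReal.ofReal_div_of_pos (by positivity), ENNReal.ofReal_mul (by norm_num)]
      simp, ENNReal.ofReal_le_ofReal_iff (by positivity)] at h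
  have hr : √(L.len w * L.len v) / L.asymDist w v < (√(2 * n))⁻¹ := by
    rw [div_lt_iff₀ h0, inv_mul_eq_div, lt_div_iff₀ (by positivity), mul_comm]
    exact hlt
  have h1 : √(2 * n : ℝ)⁻¹ ≤ 1 := Real.sqrt_le_one.2 (inv_le_one_of_one_le₀ (by linarith))
  rw [Real.sqrt_inv] at h1
  -- Here α > 2 matters: the base is at most 1, so lowering the exponent to 2 only increases the
  -- power, which becomes exactly 1/(2n).
  have h2 : (√(L.len w * L.len v) / L.asymDist w v) ^ α < (√(2 * n : ℝ))⁻¹ ^ (2 : ℝ) :=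
    (Real.rpow_lt_rpow (by positivity) hr (by linarith)).trans_le
      (Real.rpow_le_rpow_of_exponent_ge (by positivity) h1 hα.le)
  rw [Real.rpow_two, inv_pow, Real.sq_sqrt (by positivity)] at h2
  rw [one_div] at h
  linarith

theorem dist_le_of_close (hα : 2 < α) (hc : 0 < c) {v w : Fin n} (hne : v ≠ w)
    (h : L.Close α c (1 / (2 * n)) v w) :
    L.asymDist v w ≤ √(2 * n) * √(L.len v * L.len w) ∨
      L.asymDist w v ≤ √(2 * n) * √(L.len v * L.len w) := by
  rw [Close, L.affectance_singleton _ hne, L.affectance_singleton _ hne.symm, le_max_iff] at h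
  rcases h with h | h
  · exact .inl (L.dist_le_of_le_gain hα hc h)
  · refine .inr ?_
    rw [mul_comm (L.len v)]
    exact L.dist_le_of_le_gain hα hc h

/-! ### Degeneracy of the conflict graph in terms of an arbitrary schedule. -/

/-- Links of a feasible slot that are close to its link `w` are few. -/
theorem Feasible.card_le {S : Finset (Fin n)} (hS : L.Feasible α (L.meanPower α c) S)
    (hα : 0 < α) (hc : 0 < c) {F : Finset (Fin n)} (hF : F ⊆ S) {w : Fin n} (hw : w ∈ F) {q : ℝ}
    (hq : 0 < q) (h : ∀ u ∈ F, L.asymDist u w ≤ q * √(L.len u * L.len w)) :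
    (F.card : ℝ) ≤ q ^ α + 1 := by
  -- Each other link of `F` affects `w` by at least q^-α, while the whole slot affects it by less
  -- than 1.
  have h1 : ((F.erase w).card : ℝ≥0∞) * ENNReal.ofReal (q⁻¹ ^ α) < 1 := by
    refine lt_of_le_of_lt ?_ (hS w (hF hw))
    rw [affectance_eq_sum_gain, ← nsmul_eq_mul]
    refine (Finset.card_nsmul_le_sum _ _ _ fun u hu =>
      L.le_gain_of_dist_le hα hc hq (h u (Finset.mem_of_mem_erase hu))).trans ?_
    exact Finset.sum_le_sum_of_subset (Finset.erase_subset_erase _ hF)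
  rw [← ENNReal.ofReal_natCast, ← ENNReal.ofReal_mul (by positivity), ENNReal.ofReal_lt_one,
    Real.inv_rpow hq.le, mul_inv_lt_iff₀ (by positivity), one_mul, Finset.card_erase_of_mem hw,
    Nat.cast_sub (Finset.card_pos.2 ⟨w, hw⟩)] at h1
  push_cast at h1
  linarith

theorem len_le_sqrt_mul {v w : Fin n} (h : L.len v ≤ L.len w) :
    L.len v ≤ √(L.len v * L.len w) :=
  Real.le_sqrt_of_sq_le (by nlinarith [L.len_pos v])

theorem sqrt_mul_le_sqrt_mul {a b c : ℝ} (ha : 0 ≤ a) (h : b ≤ c) : √(b * a) ≤ √(c * a) :=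
  Real.sqrt_le_sqrt (by gcongr)

/-- A feasible slot contains few longer links with a sender near the receiver of `v`. -/
theorem Feasible.card_filter_sender_le {S : Finset (Fin n)}
    (hS : L.Feasible α (L.meanPower α c) S) (hα : 0 < α) (hc : 0 < c) {F : Finset (Fin n)}
    (hF : F ⊆ S) {v : Fin n} (hv : ∀ u ∈ F, L.len v ≤ L.len u)
    (h : ∀ u ∈ F, L.asymDist u v ≤ 3 * √(L.len v * L.len u)) :
    (F.card : ℝ) ≤ 7 ^ α + 1 := by
  rcases F.eq_empty_or_nonempty with rfl | hne
  · simp only [Finset.card_empty, Nat.cast_zero]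
    positivity
  -- The shortest link `w` is the victim. The path from the sender of `u` via the receiver of `v`
  -- and the sender of `w` costs 3 + 3 + 1 = 7 times √(l_u l_w), its last leg being l_w ≤ √(l_u
  -- l_w).
  obtain ⟨w, hw, hmin⟩ := F.exists_min_image L.len hne
  refine hS.card_le L hα hc hF hw (by norm_num) fun u hu => ?_
  have h1 := h u hu
  have h2 := h w hw
  have h3 : √(L.len v * L.len u) ≤ √(L.len w * L.len u) :=
    sqrt_mul_le_sqrt_mul (L.len_pos u).le (hv w hw)
  have h4 : √(L.len v * L.len w) ≤ √(L.len u * L.len w) :=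
    sqrt_mul_le_sqrt_mul (L.len_pos w).le (hv u hu)
  have h5 := L.len_le_sqrt_mul (hmin u hu)
  rw [mul_comm (L.len w)] at h3 h5
  have h6 := dist_triangle4 (L.sender u) (L.receiver v) (L.sender w) (L.receiver w)
  rw [dist_comm (L.receiver v)] at h6
  unfold asymDist len at *
  linarith

/-- A feasible slot contains few longer links with a receiver near the sender of `v`. -/
theorem Feasible.card_filter_receiver_le {S : Finset (Fin n)}
    (hS : L.Feasible α (L.meanPower α c) S) (hα : 0 < α) (hc : 0 < c) {F : Finset (Fin n)}
    (hF : F ⊆ S) {v : Fin n} (hv : ∀ u ∈ F, L.len v ≤ L.len u)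
    (h : ∀ u ∈ F, L.asymDist v u ≤ 3 * √(L.len v * L.len u)) :
    (F.card : ℝ) ≤ 7 ^ α + 1 := by
  rcases F.eq_empty_or_nonempty with rfl | hne
  · simp only [Finset.card_empty, Nat.cast_zero]
    positivity
  -- Now the path starts with the link `u` itself, so the victim must be the longest link to have
  -- l_u ≤ √(l_u l_w); the total is again 1 + 3 + 3.
  obtain ⟨w, hw, hmax⟩ := F.exists_max_image L.len hne
  refine hS.card_le L hα hc hF hw (by norm_num) fun u hu => ?_
  have h1 := h u hu
  have h2 := h w hw
  have h3 : √(L.len v * L.len u) ≤ √(L.len w * L.len u) :=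
    sqrt_mul_le_sqrt_mul (L.len_pos u).le (hv w hw)
  have h4 : √(L.len v * L.len w) ≤ √(L.len u * L.len w) :=
    sqrt_mul_le_sqrt_mul (L.len_pos w).le (hv u hu)
  have h5 := L.len_le_sqrt_mul (hmax u hu)
  rw [mul_comm (L.len w)] at h3
  have h6 := dist_triangle4 (L.sender u) (L.receiver u) (L.sender v) (L.receiver w)
  rw [dist_comm (L.receiver u)] at h6
  unfold asymDist len at *
  linarith

open scoped Classical in
/-- The degeneracy of `D_3(L)` is at most proportional to the length of a schedule. -/
theorem IsSchedule.exists_length_filter_adj_le {τ : List (Finset (Fin n))}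
    (hτ : L.IsSchedule α (L.meanPower α c) τ) (hα : 0 < α) (hc : 0 < c) {us : List (Fin n)}
    (hnd : us.Nodup) (hne : us ≠ []) :
    ∃ v ∈ us, (us.filter fun w => (L.graphD 3).Adj v w).length ≤
      τ.length * (2 * ⌊(7 : ℝ) ^ α + 1⌋₊) := by
  -- For the shortest link all neighbours are at least as long, as both counting lemmas require; the
  -- factor 2 accounts for the two kinds of adjacency.
  obtain ⟨v, hv, hmin⟩ := us.toFinset.exists_min_image L.len (by simpa using hne)
  rw [List.mem_toFinset] at hv
  refine ⟨v, hv, ?_⟩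
  set F := us.toFinset.filter fun w => (L.graphD 3).Adj v w with hF
  have hcard : (us.filter fun w => (L.graphD 3).Adj v w).length = F.card := by
    rw [← List.toFinset_card_of_nodup (hnd.filter _), List.toFinset_filter]
    simp [hF]
  have hlen : ∀ u ∈ F, L.len v ≤ L.len u := fun u hu => hmin u (Finset.mem_filter.1 hu).1
  have hslot : ∀ S ∈ τ, (F ∩ S).card ≤ 2 * ⌊(7 : ℝ) ^ α + 1⌋₊ := by
    intro S hS
    have h1 := (hτ.1 S hS).card_filter_receiver_le L hα hc (v := v)
      (F := (F ∩ S).filter fun u => L.asymDist v u ≤ 3 * √(L.len v * L.len u))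
      ((Finset.filter_subset _ _).trans Finset.inter_subset_right)
      (fun u hu => hlen u (by simp at hu; exact hu.1.1))
      (fun u hu => (Finset.mem_filter.1 hu).2)
    have h2 := (hτ.1 S hS).card_filter_sender_le L hα hc (v := v)
      (F := (F ∩ S).filter fun u => L.asymDist u v ≤ 3 * √(L.len v * L.len u))
      ((Finset.filter_subset _ _).trans Finset.inter_subset_right)
      (fun u hu => hlen u (by simp at hu; exact hu.1.1))
      (fun u hu => (Finset.mem_filter.1 hu).2)
    have h1 := Nat.le_floor h1
    have h2 := Nat.le_floor h2
    have h3 : F ∩ S ⊆ ((F ∩ S).filter fun u => L.asymDist v u ≤ 3 * √(L.len v * L.len u)) ∪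
        (F ∩ S).filter fun u => L.asymDist u v ≤ 3 * √(L.len v * L.len u) := by
      intro u hu
      have hadj := (Finset.mem_filter.1 (Finset.mem_inter.1 hu).1).2.2
      rw [mul_comm (L.len u)] at hadj
      simp only [Finset.mem_union, Finset.mem_filter]
      exact hadj.imp (fun h => ⟨hu, h⟩) (fun h => ⟨hu, h⟩)
    have := (Finset.card_le_card h3).trans (Finset.card_union_le _ _)
    omega
  have hcover : F ⊆ τ.toFinset.biUnion fun S => F ∩ S := by
    intro u hu
    obtain ⟨S, hS, huS⟩ := hτ.2.2 u
    exact Finset.mem_biUnion.2 ⟨S, by simpa using hS, Finset.mem_inter.2 ⟨hu, huS⟩⟩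
  rw [hcard]
  calc F.card ≤ _ := Finset.card_le_card hcover
    _ ≤ τ.toFinset.card * _ :=
        Finset.card_biUnion_le_card_mul _ _ _ fun S hS => hslot S (by simpa using hS)
    _ ≤ _ := Nat.mul_le_mul_right _ τ.toFinset_card_le

/-! ### Geometry of independent links. -/

theorem lt_dist_of_not_adj {q : ℝ} {v w : Fin n} (hne : v ≠ w) (h : ¬ (L.graphD q).Adj v w) :
    q * √(L.len v * L.len w) < L.asymDist v w := by
  rw [mul_comm (L.len v)]
  by_contra! hle
  exact h ⟨hne, .inl hle⟩

/-- Among independent links at most one is close to `v` and longer than `v` by a factor of more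
than `n ^ 2`. -/
theorem eq_of_close_of_not_adj (hα : 2 < α) (hc : 0 < c) {v u u' : Fin n}
    (hadj : ¬ (L.graphD 3).Adj u u') (hlen : (n : ℝ) ^ 2 * L.len v < L.len u)
    (hclose : L.Close α c (1 / (2 * n)) u v) (hlen' : (n : ℝ) ^ 2 * L.len v < L.len u')
    (hclose' : L.Close α c (1 / (2 * n)) u' v) : u = u' := by
  wlog huu' : L.len u ≤ L.len u' generalizing u u'
  · exact (this (fun h => hadj h.symm) hlen' hclose' hlen hclose (le_of_not_ge huu')).symm
  by_contra hne
  have hn1 : (1 : ℝ) ≤ n := by exact_mod_cast v.pos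
  have hlv := L.len_pos v
  have hn2 : (1 : ℝ) ≤ n ^ 2 := one_le_pow₀ hn1
  have huv : u ≠ v := by
    rintro rfl
    nlinarith
  have hu'v : u' ≠ v := by
    rintro rfl
    nlinarith
  -- Three distinct links exist, which gives room in the constants: n² ≥ 9 and 2/n ≤ 2/3 < (9/10)².
  have hn : (3 : ℝ) ≤ n := by
    have : ({u, u', v} : Finset (Fin n)).card = 3 := by
      rw [Finset.card_eq_three]
      exact ⟨u, u', v, hne, huv, hu'v, rfl⟩
    have h := Finset.card_le_univ ({u, u', v} : Finset (Fin n))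
    rw [this, Fintype.card_fin] at h
    exact_mod_cast h
  set g := √(L.len u * L.len u') with hg
  have hg0 : 0 ≤ g := Real.sqrt_nonneg _
  have hgu : L.len u ≤ g := L.len_le_sqrt_mul huu'
  have hgv : 9 * L.len v ≤ g := by
    have : (9 : ℝ) ≤ n ^ 2 := by nlinarith
    nlinarith
  -- Closeness to `v` costs at most 0.9 g for either link, each using that the other one is more
  -- than n² times longer than `v`. In all four cases a path from one link to the other has length
  -- at most (0.9 + 0.9 + 1) g, below the 3 g forced by independence.
  have key : ∀ t : ℝ, t * (n ^ 2 * L.len v) ≤ L.len u * L.len u' →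
      √(2 * n) * √(t * L.len v) ≤ 9 / 10 * g := by
    intro t ht
    rw [← Real.sqrt_mul (by positivity), show (9 / 10 : ℝ) = √(81 / 100) by
      rw [show (81 / 100 : ℝ) = (9 / 10) ^ 2 by norm_num, Real.sqrt_sq (by norm_num)], hg,
      ← Real.sqrt_mul (by norm_num)]
    refine Real.sqrt_le_sqrt ?_
    have h1 : t * L.len v * n ^ 2 ≤ L.len u * L.len u' := by linarith
    have h2 : 0 ≤ L.len u * L.len u' := (mul_pos (L.len_pos u) (L.len_pos u')).le
    rw [← mul_le_mul_iff_left₀ (show (0 : ℝ) < n by linarith)]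
    nlinarith
  have hku := key (L.len u) (by
    have := L.len_pos u
    gcongr)
  have hku' := key (L.len u') (by
    rw [mul_comm (L.len u)]
    have := L.len_pos u'
    gcongr)
  have h1 := L.lt_dist_of_not_adj hne hadj
  have h2 := L.lt_dist_of_not_adj (fun h => hne h.symm) fun h => hadj h.symm
  rw [mul_comm (L.len u'), ← hg] at h2
  rw [← hg] at h1
  have hc1 := L.dist_le_of_close hα hc huv hclose
  have hc2 := L.dist_le_of_close hα hc hu'v hclose'
  unfold asymDist at *
  unfold len at hgu hgv
  have hcu := dist_comm (L.sender u) (L.receiver u)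
  have hcv := dist_comm (L.sender v) (L.receiver v)
  rcases hc1 with hc1 | hc1 <;> rcases hc2 with hc2 | hc2
  · have := dist_triangle4 (L.sender u') (L.receiver v) (L.sender u) (L.receiver u)
    rw [dist_comm (L.receiver v)] at this
    linarith
  · have := dist_triangle4 (L.sender u) (L.receiver v) (L.sender v) (L.receiver u')
    linarith
  · have := dist_triangle4 (L.sender u') (L.receiver v) (L.sender v) (L.receiver u)
    linarith
  · have := dist_triangle4 (L.sender u) (L.receiver u) (L.sender v) (L.receiver u')
    rw [dist_comm (L.receiver u)] at this
    linarith

/-- Independent links of almost the same length have bounded affectances under uniform power. -/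
theorem affectance_uniform_le {C m : ℝ} (hX : IsDoubling X C m) (hα : 0 < α) (hm : m < α)
    {S : Finset (Fin n)} {l : ℝ} (hl : 0 < l) (hlow : ∀ v ∈ S, l ≤ L.len v)
    (hupp : ∀ v ∈ S, L.len v ≤ 2 * l)
    (hind : ∀ v ∈ S, ∀ w ∈ S, ¬ (L.graphD 3).Adj v w) {v : Fin n} (hv : v ∈ S) :
    L.affectance α uniformPower S v ≤ ENNReal.ofReal (2 ^ α * packingBound α C m) := by
  have hsqrt : ∀ u ∈ S, ∀ w ∈ S, l ≤ √(L.len u * L.len w) := fun u hu w hw =>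
    Real.le_sqrt_of_sq_le (by nlinarith [hlow u hu, hlow w hw])
  have hdist : ∀ u ∈ S, ∀ w ∈ S, u ≠ w → 3 * l ≤ L.asymDist u w := fun u hu w hw hne => by
    linarith [hsqrt u hu w hw, L.lt_dist_of_not_adj hne (hind u hu w hw)]
  have hpos : ∀ w ∈ S.erase v, 0 < L.asymDist w v := fun w hw => by
    obtain ⟨hne, hw⟩ := Finset.mem_erase.1 hw
    linarith [hdist w hw v hv hne]
  -- Senders are l-separated: a sender is at least 3l from the other receiver, and that link has
  -- length at most 2l.
  have hsum := hX.sum_rpow_le hα hm (F := S.erase v) (p := L.sender) (x := L.receiver v) hl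
    (fun a ha b hb hab => by
      have h1 := hdist a (Finset.mem_of_mem_erase ha) b (Finset.mem_of_mem_erase hb) hab
      have h2 := hupp b (Finset.mem_of_mem_erase hb)
      have h3 := dist_triangle (L.sender a) (L.sender b) (L.receiver b)
      unfold asymDist at h1
      unfold len at h2
      linarith)
    (fun a ha => by
      obtain ⟨hne, ha⟩ := Finset.mem_erase.1 ha
      have h1 := hdist a ha v hv hne
      unfold asymDist at h1
      linarith)
  rw [affectance_eq_sum_gain]
  calc _ ≤ ∑ w ∈ S.erase v, ENNReal.ofReal (2 ^ α * (l / L.asymDist w v) ^ α) := by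
        refine Finset.sum_le_sum fun w hw => ?_
        have hp := hpos w hw
        rw [L.gain_uniform_of_dist_pos hp, ← Real.mul_rpow (by norm_num) (by positivity)]
        refine ENNReal.ofReal_le_ofReal (Real.rpow_le_rpow ?_ ?_ hα.le)
        · have := L.len_pos v
          positivity
        · rw [← mul_div_assoc]
          gcongr
          exact hupp v hv
    _ = ENNReal.ofReal (2 ^ α * ∑ w ∈ S.erase v, (l / L.asymDist w v) ^ α) := by
        rw [Finset.mul_sum, ENNReal.ofReal_sum_of_nonneg]
        intro w hw
        have := hpos w hw
        positivity
    _ ≤ _ := ENNReal.ofReal_le_ofReal (by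
        gcongr
        exact hsum)

/-! ### Signal strengthening. -/

section Affectance

variable (P : Fin n → ℝ)

theorem affectance_mono {S T : Finset (Fin n)} (h : S ⊆ T) (v : Fin n) :
    L.affectance α P S v ≤ L.affectance α P T v :=
  Finset.sum_le_sum_of_subset (Finset.erase_subset_erase v h)

theorem affectance_insert_self (S : Finset (Fin n)) (v : Fin n) :
    L.affectance α P (insert v S) v = L.affectance α P S v := by
  simp only [affectance_eq_sum_gain, Finset.erase_insert_eq_erase]

theorem affectance_union_le (S T : Finset (Fin n)) (v : Fin n) :
    L.affectance α P (S ∪ T) v ≤ L.affectance α P S v + L.affectance α P T v := by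
  simp only [affectance_eq_sum_gain, Finset.erase_union_distrib]
  rw [← Finset.sum_union_inter]
  exact le_self_add

theorem affectance_toFinset {l : List (Fin n)} (hl : l.Nodup) {v : Fin n} (hv : v ∉ l) :
    L.affectance α P l.toFinset v = (l.map fun w => L.gain α P w v).sum := by
  rw [affectance_eq_sum_gain, Finset.erase_eq_of_notMem (by simpa using hv),
    List.sum_toFinset _ hl]

/-- First fit with a positive lower bound on the affectance of rejected links opens few bins. -/
theorem length_firstFit_affectance_le {f A : ℝ} (hf : 0 < f) (hA0 : 0 ≤ A) {K : List (Fin n)}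
    (hK : K.Nodup)
    (hA : ∀ v ∈ K, L.affectance α P K.toFinset v ≤ ENNReal.ofReal A) :
    (firstFit (fun B v => L.affectance α P B.toFinset v < ENNReal.ofReal (1 / (2 * f))) K).length ≤
      ⌊2 * f * A⌋₊ + 1 := by
  refine length_firstFit_le fun l x hl bins hbins hrej => Nat.le_floor ?_
  have hnd := hK.sublist hl.sublist
  have hx : x ∉ l := by
    rw [List.nodup_append] at hnd
    exact fun h => hnd.2.2 x h x (by simp) rfl
  have hndl : l.Nodup := hnd.sublist (List.sublist_append_left _ _)
  have hndb := List.nodup_flatten.1 (hbins.nodup_iff.2 hndl)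
  -- The bins are disjoint and affectance is additive: each rejecting bin uses up at least 1/(2f) of
  -- the total budget `A`.
  have h1 : (bins.length : ℝ≥0∞) * ENNReal.ofReal (1 / (2 * f)) ≤ ENNReal.ofReal A :=
    calc _ ≤ (bins.map fun B => (B.map fun w => L.gain α P w x).sum).sum := by
          refine length_le_mul_of_le_sum fun B hB => ?_
          rw [← L.affectance_toFinset P (hndb.1 B hB)
            fun h => hx (hbins.mem_iff.1 (List.mem_flatten.2 ⟨B, hB, h⟩))]
          exact not_lt.1 (hrej B hB)
      _ = (bins.flatten.map fun w => L.gain α P w x).sum := by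
          rw [List.map_flatten, List.sum_flatten, List.map_map]
          rfl
      _ = L.affectance α P l.toFinset x := by
          rw [(hbins.map _).sum_eq, L.affectance_toFinset P hndl hx]
      _ ≤ L.affectance α P K.toFinset x := by
          refine L.affectance_mono P (fun y hy => ?_) x
          rw [List.mem_toFinset] at hy ⊢
          exact hl.subset (by simp [hy])
      _ ≤ _ := hA x (hl.subset (by simp))
  rw [← ENNReal.ofReal_natCast, ← ENNReal.ofReal_mul (by positivity)] at h1
  rw [ENNReal.ofReal_le_ofReal_iff hA0, mul_one_div, div_le_iff₀ (by positivity)] at h1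
  linarith

theorem flatten_strengthen_perm (f : ℝ) (K : List (Fin n)) :
    (L.strengthen α P f K).flatten.Perm K := by
  rw [strengthen, flatten_flatMap]
  refine (flatMap_perm_flatMap (g := id) _ fun B _ =>
    (flatten_firstFit_perm _ _).trans B.reverse_perm).trans ?_
  rw [List.flatMap_id]
  exact flatten_firstFit_perm _ K

theorem length_strengthen_le {f A : ℝ} (hf : 0 < f) (hA0 : 0 ≤ A) {K : List (Fin n)}
    (hK : K.Nodup)
    (hA : ∀ v ∈ K, L.affectance α P K.toFinset v ≤ ENNReal.ofReal A) :
    (L.strengthen α P f K).length ≤ (⌊2 * f * A⌋₊ + 1) ^ 2 := by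
  rw [strengthen, sq]
  refine (length_flatMap_le _ _ fun B hB => ?_).trans
    (Nat.mul_le_mul_right _ (L.length_firstFit_affectance_le P hf hA0 hK hA))
  have hnd := (List.nodup_flatten.1 ((flatten_firstFit_perm _ _).nodup_iff.2 hK)).1 B hB
  refine L.length_firstFit_affectance_le P hf hA0 (List.nodup_reverse.2 hnd) fun v hv => ?_
  refine (L.affectance_mono P (fun w hw => ?_) v).trans
    (hA v (mem_of_mem_firstFit hB (List.mem_reverse.1 hv)))
  rw [List.mem_toFinset, List.mem_reverse] at hw
  exact List.mem_toFinset.2 (mem_of_mem_firstFit hB hw)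

/-- The two passes control the two sides of `v` in its slot: the second pass bounds the links before
`v`, and those after `v` preceded it in the first pass. Each side adds less than 1/(2f). -/
theorem affectance_lt_of_mem_strengthen {f : ℝ} (hf : 0 < f) {K S : List (Fin n)}
    (hS : S ∈ L.strengthen α P f K) {v : Fin n} (hv : v ∈ S) :
    L.affectance α P S.toFinset v < ENNReal.ofReal (1 / f) := by
  obtain ⟨B, hB, hS⟩ := List.mem_flatMap.1 hS
  have hnil : ∀ x, L.affectance α P ([] : List (Fin n)).toFinset x <
      ENNReal.ofReal (1 / (2 * f)) := fun x => by
    simp [affectance, hf]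
  have hBok := (sublist_and_ok_of_mem_firstFit hnil hB).2
  obtain ⟨hsub, hSok⟩ := sublist_and_ok_of_mem_firstFit hnil hS
  obtain ⟨l₁, l₂, rfl⟩ := List.append_of_mem hv
  have h1 := hSok l₁ v ⟨l₂, by simp⟩
  -- The reversed slot is a sublist of `B`, so `l₂` lies in the prefix of `B` that admitted `v`.
  have h2 : L.affectance α P l₂.toFinset v < ENNReal.ofReal (1 / (2 * f)) := by
    have hrev := hsub.reverse
    rw [List.reverse_reverse, List.reverse_append, List.reverse_cons, List.append_assoc,
      List.append_sublist_iff] at hrev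
    obtain ⟨r₁, r₂, rfl, h₁, h₂⟩ := hrev
    rw [List.singleton_append, List.cons_sublist_iff] at h₂
    obtain ⟨r₃, r₄, rfl, h₃, -⟩ := h₂
    obtain ⟨r₅, r₆, rfl⟩ := List.append_of_mem h₃
    refine (L.affectance_mono P (fun w hw => ?_) v).trans_lt
      (hBok (r₁ ++ r₅) v ⟨r₆ ++ r₄, by simp⟩)
    simp only [List.mem_toFinset, List.mem_append] at hw ⊢
    exact .inl (h₁.subset (List.mem_reverse.2 hw))
  have h3 : (l₁ ++ v :: l₂).toFinset = insert v (l₁.toFinset ∪ l₂.toFinset) := by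
    ext w
    simp
  rw [h3, affectance_insert_self]
  calc _ ≤ _ := L.affectance_union_le P _ _ v
    _ < ENNReal.ofReal (1 / (2 * f)) + ENNReal.ofReal (1 / (2 * f)) := ENNReal.add_lt_add h1 h2
    _ = _ := by
        rw [← ENNReal.ofReal_add (by positivity) (by positivity)]
        congr 1
        field_simp
        norm_num

end Affectance

/-! ### Feasibility and number of the distributed slots. -/

theorem gain_meanPower_le (hα : 0 < α) (hc : 0 < c) {v w : Fin n}
    (h : L.len w ≤ 2 * L.len v) :
    L.gain α (L.meanPower α c) w v ≤
      ENNReal.ofReal (2 ^ (α / 2)) * L.gain α uniformPower w v := by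
  have h0 : 0 ≤ L.asymDist w v := dist_nonneg
  rcases h0.eq_or_lt with h0 | h0
  · rw [L.gain_of_dist_eq_zero (P := uniformPower) hα (fun _ => one_pos) h0.symm,
      ENNReal.mul_top]
    · exact le_top
    · simp only [ne_eq, ENNReal.ofReal_eq_zero, not_le]
      positivity
  · rw [L.gain_of_dist_pos (L.meanPower_pos hc) h0, L.gain_uniform_of_dist_pos h0,
      ← ENNReal.ofReal_mul (by positivity)]
    have hv := L.len_pos v
    refine ENNReal.ofReal_le_ofReal (mul_le_mul_of_nonneg_right ?_ (by positivity))
    rw [meanPower, meanPower, mul_div_mul_left _ _ hc.ne', ← Real.div_rpow (L.len_pos w).le hv.le]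
    exact Real.rpow_le_rpow (div_nonneg (L.len_pos w).le hv.le) ((div_le_iff₀ hv).2 h)
      (by positivity)

theorem gain_le_of_not_close {τ : ℝ≥0∞} {v w : Fin n} (hne : v ≠ w) (h : ¬ L.Close α c τ v w) :
    L.gain α (L.meanPower α c) v w ≤ τ ∧ L.gain α (L.meanPower α c) w v ≤ τ := by
  rw [Close, L.affectance_singleton _ hne, L.affectance_singleton _ hne.symm, not_le,
    max_lt_iff] at h
  exact ⟨h.1.le, h.2.le⟩

theorem flatten_distribute_perm (S : List (Fin n)) : (L.distribute α c S).flatten.Perm S :=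
  (flatten_firstFit_perm _ _).trans (List.perm_insertionSort _ _)

/-- Admission looks only at links already placed. The sorting makes this enough: a link placed later
is never longer, so the condition in the other direction is void. -/
theorem not_close_of_mem_distribute {S T : List (Fin n)} (hT : T ∈ L.distribute α c S)
    {v w : Fin n} (hv : v ∈ T) (hw : w ∈ T) (h : (n : ℝ) ^ 2 * L.len w < L.len v) :
    ¬ L.Close α c (1 / (2 * n)) v w := by
  classical
  obtain ⟨hsub, hok⟩ := sublist_and_ok_of_mem_firstFit (by simp) hT
  have : Std.Total fun v w : Fin n => L.len w ≤ L.len v := ⟨fun v w => le_total _ _⟩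
  have : IsTrans (Fin n) fun v w => L.len w ≤ L.len v := ⟨fun _ _ _ h h' => h'.trans h⟩
  have hsorted := (List.pairwise_insertionSort (fun v w => L.len w ≤ L.len v) S).sublist hsub
  have hpair := pairwise_of_forall_prefix hok
  have hn : ∀ v : Fin n, L.len v ≤ (n : ℝ) ^ 2 * L.len v := fun v =>
    le_mul_of_one_le_left (L.len_pos v).le (one_le_pow₀ (by exact_mod_cast v.pos))
  let r : Fin n → Fin n → Prop := fun a b =>
    (n : ℝ) ^ 2 * L.len b < L.len a → ¬ L.Close α c (1 / (2 * n)) a b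
  have hsymm : Std.Symm fun a b => r a b ∧ r b a := ⟨fun _ _ h => h.symm⟩
  have hr : T.Pairwise fun a b => r a b ∧ r b a :=
    hpair.imp₂ (fun a b hab hle => ⟨fun h h' => hab ⟨h, h'⟩, fun h => by
      have := hn a
      linarith⟩) hsorted
  have hne : v ≠ w := by
    rintro rfl
    exact absurd (hn v) (not_le.2 h)
  exact (hr.forall hv hw hne).1 h

theorem one_div_two_mul_natCast (hn : 0 < n) :
    (n : ℝ≥0∞) * (1 / (2 * n)) = ENNReal.ofReal (1 / 2) := by
  have : (0 : ℝ) < n := by exact_mod_cast hn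
  rw [show (1 / (2 * n) : ℝ≥0∞) = ENNReal.ofReal (1 / (2 * n)) by
      rw [ENNReal.ofReal_div_of_pos (by positivity), ENNReal.ofReal_mul (by norm_num)]
      simp, ← ENNReal.ofReal_natCast, ← ENNReal.ofReal_mul (by positivity)]
  congr 1
  field_simp

/-- Slots produced from strengthened slots of well-separated length classes are feasible. -/
theorem feasible_of_mem_distribute (hα : 0 < α) (hc : 0 < c) {S T : List (Fin n)} {κ : Fin n → ℕ}
    (hclass : ∀ v ∈ S, ∃ R : Finset (Fin n), (∀ w ∈ S, κ w = κ v → w ∈ R) ∧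
      L.affectance α uniformPower R v < ENNReal.ofReal (1 / 2 ^ (α / 2 + 1)))
    (hlen : ∀ v ∈ S, ∀ w ∈ S, κ w = κ v → L.len w ≤ 2 * L.len v)
    (hsep : ∀ v ∈ S, ∀ w ∈ S, κ v < κ w → (n : ℝ) ^ 2 * L.len v < L.len w)
    (hT : T ∈ L.distribute α c S) : L.Feasible α (L.meanPower α c) T.toFinset := by
  have hTS : ∀ v ∈ T, v ∈ S := fun v hv =>
    (L.flatten_distribute_perm S).mem_iff.1 (List.mem_flatten.2 ⟨T, hT, hv⟩)
  intro v hv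
  rw [List.mem_toFinset] at hv
  obtain ⟨R, hR, hRv⟩ := hclass v (hTS v hv)
  rw [affectance_eq_sum_gain, ← Finset.sum_filter_add_sum_filter_not _ fun w => κ w = κ v]
  have h1 : ∑ w ∈ T.toFinset.erase v with κ w = κ v, L.gain α (L.meanPower α c) w v <
      ENNReal.ofReal (1 / 2) :=
    calc _ ≤ ∑ w ∈ T.toFinset.erase v with κ w = κ v,
          ENNReal.ofReal (2 ^ (α / 2)) * L.gain α uniformPower w v := by
          refine Finset.sum_le_sum fun w hw => L.gain_meanPower_le hα hc ?_
          simp only [Finset.mem_filter, Finset.mem_erase, List.mem_toFinset] at hw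
          exact hlen v (hTS v hv) w (hTS w hw.1.2) hw.2
      _ ≤ ENNReal.ofReal (2 ^ (α / 2)) * L.affectance α uniformPower R v := by
          rw [← Finset.mul_sum, affectance_eq_sum_gain]
          gcongr
          intro w hw
          simp only [Finset.mem_filter, Finset.mem_erase, List.mem_toFinset] at hw ⊢
          exact ⟨hw.1.1, hR w (hTS w hw.1.2) hw.2⟩
      _ < ENNReal.ofReal (2 ^ (α / 2)) * ENNReal.ofReal (1 / 2 ^ (α / 2 + 1)) :=
          ENNReal.mul_lt_mul_right (by
            simp only [ne_eq, ENNReal.ofReal_eq_zero, not_le]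
            positivity) ENNReal.ofReal_ne_top hRv
      _ = _ := by
          rw [← ENNReal.ofReal_mul (by positivity)]
          congr 1
          rw [Real.rpow_add_one (by norm_num)]
          field_simp
  -- At most n links at 1/(2n) each. This half need not be strict, since the same-class half is.
  have h2 : ∑ w ∈ T.toFinset.erase v with ¬ κ w = κ v, L.gain α (L.meanPower α c) w v ≤
      ENNReal.ofReal (1 / 2) := by
    refine (Finset.sum_le_card_nsmul _ _ (1 / (2 * n) : ℝ≥0∞) fun w hw => ?_).trans ?_
    · simp only [Finset.mem_filter, Finset.mem_erase, List.mem_toFinset] at hw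
      obtain ⟨⟨hne, hw⟩, hκ⟩ := hw
      rcases lt_or_gt_of_ne hκ with hκ | hκ
      · exact (L.gain_le_of_not_close hne.symm (L.not_close_of_mem_distribute hT hv hw
          (hsep w (hTS w hw) v (hTS v hv) hκ))).2
      · exact (L.gain_le_of_not_close hne (L.not_close_of_mem_distribute hT hw hv
          (hsep v (hTS v hv) w (hTS w hw) hκ))).1
    · rw [nsmul_eq_mul, ← one_div_two_mul_natCast v.pos]
      gcongr
      exact_mod_cast (Finset.card_le_univ _).trans_eq (Fintype.card_fin n)
  calc _ < ENNReal.ofReal (1 / 2) + ENNReal.ofReal (1 / 2) :=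
        ENNReal.add_lt_add_of_lt_of_le (h2.trans_lt ENNReal.ofReal_lt_top).ne h1 h2
    _ = 1 := by
        rw [← ENNReal.ofReal_add (by norm_num) (by norm_num)]
        norm_num

/-- A rejecting slot contains a much longer link close to the new one. Independence allows only one
such link, so at most one slot ever rejects. -/
theorem length_distribute_le (hα : 2 < α) (hc : 0 < c) {S : List (Fin n)} (hS : S.Nodup)
    (hind : ∀ v ∈ S, ∀ w ∈ S, ¬ (L.graphD 3).Adj v w) : (L.distribute α c S).length ≤ 2 := by
  classical
  refine length_firstFit_le fun l x hl bins hbins hrej => ?_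
  set p : Fin n → Prop := fun u =>
    (n : ℝ) ^ 2 * L.len x < L.len u ∧ L.Close α c (1 / (2 * n)) u x
  have hmem : ∀ u ∈ l, u ∈ S := fun u hu =>
    (List.mem_insertionSort _).1 (hl.subset (by simp [hu]))
  have hnd : l.Nodup := ((List.perm_insertionSort _ S).nodup_iff.2 hS).sublist
    ((List.sublist_append_left _ _).trans hl.sublist)
  refine (length_le_countP_flatten (fun u => decide (p u)) bins fun B hB => ?_).trans ?_
  · simpa [p] using hrej B hB
  · rw [hbins.countP_eq, List.countP_eq_length_filter,
      ← List.toFinset_card_of_nodup (hnd.filter _), Finset.card_le_one]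
    intro u hu w hw
    simp only [List.mem_toFinset, List.mem_filter, decide_eq_true_eq] at hu hw
    exact L.eq_of_close_of_not_adj hα hc (hind u (hmem u hu.1) w (hmem w hw.1))
      hu.2.1 hu.2.2 hw.2.1 hw.2.2

/-! ### Length classes and the analysis of Algorithm 1. -/

section LengthClass

variable (Q : List (Fin n))

theorem exists_lengthClass_bounds : ∃ l : ℝ, 0 < l ∧ ∀ v ∈ Q,
    2 ^ L.lengthClass Q v * l ≤ L.len v ∧ L.len v < 2 ^ (L.lengthClass Q v + 1) * l := by
  rcases Q.eq_nil_or_concat with rfl | hQ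
  · exact ⟨1, one_pos, by simp⟩
  have hne : (L.len '' {w | w ∈ Q}).Nonempty := by
    obtain ⟨l, x, rfl⟩ := hQ
    exact ⟨_, x, by simp, rfl⟩
  have hfin : (L.len '' {w | w ∈ Q}).Finite := Set.toFinite _
  have hl : 0 < sInf (L.len '' {w | w ∈ Q}) := by
    obtain ⟨w, -, hw⟩ := hne.csInf_mem hfin
    exact hw ▸ L.len_pos w
  refine ⟨_, hl, fun v hv => ?_⟩
  have hle : sInf (L.len '' {w | w ∈ Q}) ≤ L.len v := csInf_le hfin.bddBelow ⟨v, hv, rfl⟩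
  exact ⟨(le_div_iff₀ hl).1 (two_pow_floor_logb_le ((one_le_div hl).2 hle)),
    (div_lt_iff₀ hl).1 (lt_two_pow_floor_logb (div_pos (L.len_pos v) hl))⟩

/-- The slots into which the length classes that meet `B` are refined. -/
noncomputable def refinedClasses (α : ℝ) (B : List (Fin n)) : List (List (List (Fin n))) :=
  (B.map (L.lengthClass Q)).dedup.map fun k =>
    L.strengthen α uniformPower (2 ^ (α / 2 + 1)) (B.filter fun v => L.lengthClass Q v = k)

/-- The links of `Q` whose length class is congruent to `i` modulo `M`. -/
noncomputable def family (M i : ℕ) : List (Fin n) :=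
  Q.filter fun v => L.lengthClass Q v % M = i

theorem scheduleIndependent_eq : L.scheduleIndependent α c Q =
    (List.range (Nat.clog 2 (n ^ 2) + 1)).flatMap fun i =>
      (List.range (((L.refinedClasses Q α (L.family Q (Nat.clog 2 (n ^ 2) + 1) i)).map
        List.length).foldr max 0)).flatMap fun s =>
          L.distribute α c ((L.refinedClasses Q α
            (L.family Q (Nat.clog 2 (n ^ 2) + 1) i)).flatMap fun slots => slots.getD s []) :=
  rfl

theorem flatMap_flatten_refinedClasses_perm (B : List (Fin n)) :
    ((L.refinedClasses Q α B).flatMap List.flatten).Perm B := by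
  rw [refinedClasses, List.flatMap_map]
  refine (flatMap_perm_flatMap _ fun k _ => L.flatten_strengthen_perm _ _ _).trans ?_
  exact flatMap_filter_perm (L.lengthClass Q) (List.nodup_dedup _) B fun x hx => by
    rw [List.mem_dedup]
    exact List.mem_map_of_mem hx

theorem flatMap_flatMap_refinedClasses_perm (B : List (Fin n)) :
    ((List.range (((L.refinedClasses Q α B).map List.length).foldr max 0)).flatMap fun s =>
      (L.refinedClasses Q α B).flatMap fun slots => slots.getD s []).Perm B :=
  (flatMap_flatMap_getD_perm _ (length_le_foldr_max _)).trans
    (L.flatMap_flatten_refinedClasses_perm Q B)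

theorem flatten_scheduleIndependent_perm : (L.scheduleIndependent α c Q).flatten.Perm Q := by
  rw [scheduleIndependent_eq, flatten_flatMap]
  refine (flatMap_perm_flatMap _ fun i _ => ?_).trans
    (flatMap_filter_perm (fun v => L.lengthClass Q v % (Nat.clog 2 (n ^ 2) + 1))
      List.nodup_range Q fun x _ => List.mem_range.2 (Nat.mod_lt _ (Nat.succ_pos _)))
  rw [flatten_flatMap]
  exact (flatMap_perm_flatMap _ fun s _ => L.flatten_distribute_perm _).trans
    (L.flatMap_flatMap_refinedClasses_perm Q _)

theorem mem_of_mem_getD {β : Type*} {l : List (List β)} {s : ℕ} {v : β} (h : v ∈ l.getD s []) :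
    l.getD s [] ∈ l := by
  by_cases hs : s < l.length
  · rw [List.getD_eq_getElem _ _ hs]
    exact List.getElem_mem hs
  · rw [List.getD_eq_default _ _ (by omega)] at h
    simp at h

/-- All links of one class in the `s`-th union come from one strengthened slot, so the strengthened
bound applies to them jointly. -/
theorem mem_refinedClasses_getD {B : List (Fin n)} {s : ℕ} {v : Fin n}
    (hv : v ∈ (L.refinedClasses Q α B).flatMap fun slots => slots.getD s []) :
    v ∈ B ∧ v ∈ (L.strengthen α uniformPower (2 ^ (α / 2 + 1))
      (B.filter fun w => L.lengthClass Q w = L.lengthClass Q v)).getD s [] := by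
  obtain ⟨slots, hslots, hv⟩ := List.mem_flatMap.1 hv
  obtain ⟨k, -, rfl⟩ := List.mem_map.1 hslots
  have := (L.flatten_strengthen_perm _ _ _).mem_iff.1
    (List.mem_flatten.2 ⟨_, mem_of_mem_getD hv, hv⟩)
  simp only [List.mem_filter, decide_eq_true_eq] at this
  obtain ⟨hB, rfl⟩ := this
  exact ⟨hB, hv⟩

theorem feasible_of_mem_scheduleIndependent (hα : 0 < α) (hc : 0 < c) {T : List (Fin n)}
    (hT : T ∈ L.scheduleIndependent α c Q) : L.Feasible α (L.meanPower α c) T.toFinset := by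
  rw [scheduleIndependent_eq] at hT
  obtain ⟨i, -, hT⟩ := List.mem_flatMap.1 hT
  obtain ⟨s, -, hT⟩ := List.mem_flatMap.1 hT
  obtain ⟨l, hl, hb⟩ := L.exists_lengthClass_bounds Q
  have hmem := fun v hv => L.mem_refinedClasses_getD (α := α) (s := s)
    (B := L.family Q (Nat.clog 2 (n ^ 2) + 1) i) (v := v) Q hv
  have hfam : ∀ v ∈ L.family Q (Nat.clog 2 (n ^ 2) + 1) i,
      v ∈ Q ∧ L.lengthClass Q v % (Nat.clog 2 (n ^ 2) + 1) = i := fun v hv => by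
    simpa [family] using hv
  refine L.feasible_of_mem_distribute hα hc (κ := L.lengthClass Q) ?_ ?_ ?_ hT
  · intro v hv
    have h1 := (hmem v hv).2
    refine ⟨_, fun w hw hwv => ?_, L.affectance_lt_of_mem_strengthen _ (by positivity)
      (mem_of_mem_getD h1) h1⟩
    have h2 := (hmem w hw).2
    rw [hwv] at h2
    exact List.mem_toFinset.2 h2
  · intro v hv w hw hwv
    have h1 := hb v (hfam v (hmem v hv).1).1
    have h2 := hb w (hfam w (hmem w hw).1).1
    rw [hwv, pow_succ] at h2
    linarith
  · intro v hv w hw hvw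
    obtain ⟨hvQ, hvi⟩ := hfam v (hmem v hv).1
    obtain ⟨hwQ, hwi⟩ := hfam w (hmem w hw).1
    have h1 := hb v hvQ
    have h2 := hb w hwQ
    have hmod : (Nat.clog 2 (n ^ 2) + 1) ∣ L.lengthClass Q w - L.lengthClass Q v :=
      (Nat.modEq_iff_dvd' hvw.le).1 (hvi.trans hwi.symm)
    -- Distinct congruent classes differ by at least M. The extra 1 in M pays for the width of a
    -- class, leaving a length ratio above 2^clog(n²) ≥ n².
    have hge : L.lengthClass Q v + 1 + Nat.clog 2 (n ^ 2) ≤ L.lengthClass Q w := by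
      have := Nat.le_of_dvd (by omega) hmod
      omega
    have hn : (n : ℝ) ^ 2 ≤ 2 ^ Nat.clog 2 (n ^ 2) := by
      exact_mod_cast Nat.le_pow_clog (by norm_num) (n ^ 2)
    have hn0 : (0 : ℝ) < n := by exact_mod_cast v.pos
    calc (n : ℝ) ^ 2 * L.len v < (n : ℝ) ^ 2 * (2 ^ (L.lengthClass Q v + 1) * l) := by
          gcongr
          exact h1.2
      _ ≤ 2 ^ Nat.clog 2 (n ^ 2) * (2 ^ (L.lengthClass Q v + 1) * l) := by gcongr
      _ = 2 ^ (L.lengthClass Q v + 1 + Nat.clog 2 (n ^ 2)) * l := by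
          rw [pow_add _ (L.lengthClass Q v + 1)]
          ring
      _ ≤ 2 ^ L.lengthClass Q w * l := by
          gcongr
          norm_num
      _ ≤ L.len w := h2.1

/-- A bound for the number of slots into which an independent length class is refined. -/
noncomputable def strengthenBound (α C m : ℝ) : ℕ :=
  (⌊2 * (2 : ℝ) ^ (α / 2 + 1) * (2 ^ α * packingBound α C m)⌋₊ + 1) ^ 2

theorem length_scheduleIndependent_le {C m : ℝ} (hX : IsDoubling X C m) (hα : 2 < α) (hm : m < α)
    (hc : 0 < c) (hQ : Q.Nodup) (hind : ∀ v ∈ Q, ∀ w ∈ Q, ¬ (L.graphD 3).Adj v w) :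
    (L.scheduleIndependent α c Q).length ≤
      (Nat.clog 2 (n ^ 2) + 1) * (strengthenBound α C m * 2) := by
  have hα0 : 0 < α := by linarith
  rw [scheduleIndependent_eq]
  refine (length_flatMap_le _ _ fun i _ => ?_).trans_eq (by rw [List.length_range])
  set B := L.family Q (Nat.clog 2 (n ^ 2) + 1) i with hB
  have hBQ : B.Sublist Q := List.filter_sublist
  obtain ⟨l, hl, hb⟩ := L.exists_lengthClass_bounds Q
  have hperm := L.flatMap_flatMap_refinedClasses_perm (α := α) Q B
  refine (length_flatMap_le _ _ (N := 2) fun s hs => ?_).trans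
    (Nat.mul_le_mul_right _ ?_)
  · have hnd := (List.nodup_flatMap.1 (hperm.nodup_iff.2 (hQ.sublist hBQ))).1 s hs
    have hmem := fun v hv => hBQ.subset (L.mem_refinedClasses_getD (α := α) (s := s) (v := v) Q hv).1
    exact L.length_distribute_le hα hc hnd fun v hv w hw => hind v (hmem v hv) w (hmem w hw)
  · rw [List.length_range]
    refine foldr_max_le _ fun slots hslots => ?_
    obtain ⟨k, -, rfl⟩ := List.mem_map.1 hslots
    have hK : ∀ v ∈ (B.filter fun v => L.lengthClass Q v = k).toFinset,
        v ∈ Q ∧ L.lengthClass Q v = k := fun v hv => by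
      simp only [List.mem_toFinset, List.mem_filter, decide_eq_true_eq] at hv
      exact ⟨hBQ.subset hv.1, hv.2⟩
    refine L.length_strengthen_le _ (by positivity)
      (mul_nonneg (by positivity) (packingBound_nonneg hα0 hm)) ((hQ.sublist hBQ).filter _) fun v hv => ?_
    refine L.affectance_uniform_le hX hα0 hm (l := 2 ^ k * l) (by positivity) ?_ ?_ ?_
      (List.mem_toFinset.2 hv)
    · intro w hw
      obtain ⟨hwQ, rfl⟩ := hK w hw
      exact (hb w hwQ).1
    · intro w hw
      obtain ⟨hwQ, rfl⟩ := hK w hw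
      have := (hb w hwQ).2
      rw [pow_succ] at this
      linarith
    · exact fun v hv w hw => hind v (hK v hv).1 w (hK w hw).1

end LengthClass

/-! ### Algorithm 2 and the final constant. -/

theorem flatten_colourClasses_flatMap_perm :
    ((colourClasses (L.graphD 3) (List.finRange n)).flatMap
      (L.scheduleIndependent α c)).flatten.Perm (List.finRange n) := by
  rw [flatten_flatMap]
  refine (flatMap_perm_flatMap (g := id) _ fun Q _ =>
    L.flatten_scheduleIndependent_perm Q).trans ?_
  rw [List.flatMap_id]
  exact flatten_colourClasses_perm _ _

theorem isSchedule_schedule (hα : 0 < α) (hc : 0 < c) :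
    L.IsSchedule α (L.meanPower α c) (L.schedule α c) := by
  have hperm := L.flatten_colourClasses_flatMap_perm (α := α) (c := c)
  refine ⟨fun S hS => ?_, ?_, fun v => ?_⟩
  · obtain ⟨T, hT, rfl⟩ := List.mem_map.1 hS
    obtain ⟨Q, -, hT⟩ := List.mem_flatMap.1 hT
    exact L.feasible_of_mem_scheduleIndependent Q hα hc hT
  · have := (List.nodup_flatten.1 (hperm.nodup_iff.2 (List.nodup_finRange n))).2
    exact List.pairwise_map.2 (this.imp fun h => List.disjoint_toFinset_iff_disjoint.2 h)
  · obtain ⟨T, hT, hv⟩ := List.mem_flatten.1 (hperm.mem_iff.2 (List.mem_finRange v))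
    exact ⟨T.toFinset, List.mem_map_of_mem hT, List.mem_toFinset.2 hv⟩

theorem length_schedule_le {C m : ℝ} (hX : IsDoubling X C m) (hα : 2 < α) (hm : m < α)
    (hc : 0 < c) {τ : List (Finset (Fin n))} (hτ : L.IsSchedule α (L.meanPower α c) τ) :
    (L.schedule α c).length ≤ (τ.length * (2 * ⌊(7 : ℝ) ^ α + 1⌋₊) + 1) *
      ((Nat.clog 2 (n ^ 2) + 1) * (strengthenBound α C m * 2)) := by
  rw [schedule, List.length_map]
  have hnd := (flatten_colourClasses_perm (L.graphD 3) (List.finRange n)).nodup_iff.2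
    (List.nodup_finRange n)
  refine (length_flatMap_le _ _ fun Q hQ => ?_).trans (Nat.mul_le_mul_right _ ?_)
  · exact L.length_scheduleIndependent_le Q hX hα hm hc ((List.nodup_flatten.1 hnd).1 Q hQ)
      fun v hv w hw => not_adj_of_mem_colourClasses hQ hv hw
  · exact length_colourClasses_le _ _ fun us hus hne =>
      hτ.exists_length_filter_adj_le L (by linarith) hc
        ((List.nodup_finRange n).sublist hus) hne

end Links

theorem clog_two_sq_add_one_le {n : ℕ} (hn : 2 ≤ n) :
    ((Nat.clog 2 (n ^ 2) + 1 : ℕ) : ℝ) ≤ 4 / Real.log 2 * Real.log n := by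
  have h2 : 0 < Real.log 2 := Real.log_pos (by norm_num)
  have hlog : Real.log 2 ≤ Real.log n := Real.log_le_log (by norm_num) (by exact_mod_cast hn)
  have h0 : 0 ≤ Real.logb 2 ((n ^ 2 : ℕ) : ℝ) :=
    Real.logb_nonneg (by norm_num) (by exact_mod_cast Nat.one_le_pow _ _ (by omega))
  have h1 : (Nat.clog 2 (n ^ 2) : ℝ) < Real.logb 2 ((n ^ 2 : ℕ) : ℝ) + 1 := by
    rw [← Real.natCeil_logb_natCast]
    exact_mod_cast Nat.ceil_lt_add_one h0
  rw [Real.logb, Nat.cast_pow, Real.log_pow] at h1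
  -- The bound 2 log₂ n + 2 becomes 4 log₂ n because n ≥ 2.
  have h3 : 1 ≤ Real.log n / Real.log 2 := (one_le_div h2).2 hlog
  rw [mul_div_assoc] at h1
  push_cast at h1 ⊢
  rw [div_mul_eq_mul_div, mul_div_assoc]
  linarith

end Wireless

theorem theoremT (α C m : ℝ) (hα : 2 < α) (hm : m < α) :
    ∃ K : ℝ, ∀ (X : Type*) [MetricSpace X], Wireless.IsDoubling X C m →
      ∀ (n : ℕ) (L : Wireless.Links X n) (c : ℝ), 0 < c →
        L.IsSchedule α (L.meanPower α c) (L.schedule α c) ∧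
        (2 ≤ n → ∀ τ : List (Finset (Fin n)), L.IsSchedule α (L.meanPower α c) τ →
          ((L.schedule α c).length : ℝ) ≤ K * Real.log n * τ.length) := by
  set D : ℕ := 2 * ⌊(7 : ℝ) ^ α + 1⌋₊
  set N : ℕ := Wireless.Links.strengthenBound α C m
  refine ⟨(D + 1) * (4 / Real.log 2) * (N * 2), fun X _ hX n L c hc =>
    ⟨L.isSchedule_schedule (by linarith) hc, fun hn τ hτ => ?_⟩⟩
  -- A link exists, so τ is nonempty and the extra colour beyond the degeneracy is absorbed into the
  -- factor |τ|.
  have hτ1 : 1 ≤ τ.length := by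
    obtain ⟨S, hS, -⟩ := hτ.2.2 ⟨0, by omega⟩
    exact List.length_pos_of_mem hS
  have h1 : τ.length * D + 1 ≤ τ.length * (D + 1) := by
    rw [mul_add]
    omega
  have h2 := (L.length_schedule_le hX hα hm hc hτ).trans (Nat.mul_le_mul_right _ h1)
  have h3 : ((L.schedule α c).length : ℝ) ≤
      τ.length * (D + 1) * ((Nat.clog 2 (n ^ 2) + 1 : ℕ) * (N * 2)) := by
    exact_mod_cast h2
  have h4 := Wireless.clog_two_sq_add_one_le hn
  calc ((L.schedule α c).length : ℝ) ≤ _ := h3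
    _ ≤ τ.length * (D + 1) * (4 / Real.log 2 * Real.log n * (N * 2)) := by gcongr
    _ = _ := by ring
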